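/- Let $X$ be a topological space. A (strict) well-ordering $\prec$ of $X$ is left-separating if $\{x\in X: x\prec y\}$ is closed in $X$ for every $y\in X$. The space $X$ is left-separated if it has a left-separating well-ordering, and its left-separating type $\operatorname{ord}_\ell(X)$ is then the minimum of the order types of its left-separating well-orderings. The space $X$ is scattered if every non-empty subspace of $X$ has an isolated point. Theorem. Let $\kappa$ be a regular uncountable cardinal and let $\alpha<\kappa^+$ be an ordinal. Then there is a first countable, scattered, Hausdorff, left-separated space $Y$ such that $\operatorname{ord}_\ell(Y)=\kappa\cdot\alpha$ (ordinal product). -/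

import Mathlib

universe u

/-- A topological space is scattered if every non-empty subspace has an isolated point. -/
def IsScattered (X : Type*) [TopologicalSpace X] : Prop :=
  ∀ S : Set X, S.Nonempty → ∃ x : S, IsOpen ({x} : Set S)

/-- A (strict) well-ordering `r` of a topological space is left-separating if every proper initial
segment `{x | r x y}` is closed. -/
structure IsLeftSeparating {X : Type*} [TopologicalSpace X] (r : X → X → Prop) : Prop where
  isWellOrder : IsWellOrder X r
  isClosed_initial : ∀ y : X, IsClosed {x : X | r x y}

/-- A space is left-separated if it has a left-separating well-ordering. -/
def IsLeftSeparated (X : Type*) [TopologicalSpace X] : Prop :=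
  ∃ r : X → X → Prop, IsLeftSeparating r

/-- The set of order types of the left-separating well-orderings of a space. -/
def leftSeparatingOrderTypes (X : Type*) [TopologicalSpace X] : Set Ordinal :=
  {o | ∃ (r : X → X → Prop) (h : IsLeftSeparating r), @Ordinal.type X r h.isWellOrder = o}

/-- The left-separating type of a left-separated space: the minimum of the order types of its
left-separating well-orderings. It is meaningful only for left-separated spaces. -/
noncomputable def leftSeparatingType (X : Type*) [TopologicalSpace X] : Ordinal :=
  sInf (leftSeparatingOrderTypes X)

/-- For a left-separated space the infimum in the definition of `leftSeparatingType` is attained,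
so it is a minimum. -/
theorem leftSeparatingType_mem {X : Type*} [TopologicalSpace X] (h : IsLeftSeparated X) :
    leftSeparatingType X ∈ leftSeparatingOrderTypes X := by
  obtain ⟨r, hr⟩ := h
  exact csInf_mem ⟨_, r, hr, rfl⟩

/-! Split the points of `κ` of countable character into `κ` many disjoint stationary (non-thin)
sets, and give each point a level below `α`. A neighbourhood of `δ` consists of `δ` and the
higher-level points of an interval below `δ`. Ordering by level, then by position in `κ`, is
left-separating and has type at most `κ * α`.

For the lower bound, any left-separating order puts each point before the higher-level points just
below it. The lower ends of these intervals form a regressive function, so on a stationary set of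
lower level unboundedly many points share a bound `v`. Hence a higher-level point above `v` comes
after unboundedly many of them (`bddAbove_of_forall_lt_bddAbove`). By induction on `i`, only
boundedly many points of a stationary set of level `i` come before position `κ * i + β` with `β < κ`
(`IsRegularOrder.bddAbove_mul_add`). An order of type `κ * i + β` with `i < α` would make that set
bounded. -/

open Set Cardinal

/-! ### Stationary sets and pressing down. -/

section Thin

variable {K : Type u} [LinearOrder K]

/-- A set is thin (nonstationary) if some function which is regressive on it has only bounded
sublevel sets; points at which the function is not regressive count for every sublevel set. -/
def IsThin (A : Set K) : Prop :=
  ∃ h : K → K, ∀ v, BddAbove {δ ∈ A | h δ < δ → h δ ≤ v}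

/-- The points that are the supremum of countably many strictly smaller points, in the sense
that these are cofinal below them. -/
def countablyApproachable (K : Type u) [LinearOrder K] : Set K :=
  {δ | ∃ c : ℕ → K, (∀ n, c n < δ) ∧ ∀ x < δ, ∃ n, x ≤ c n}

/-- An order in which bounded sets are exactly those of cardinality less than `κ`. -/
structure IsRegularOrder (K : Type u) [LinearOrder K] (κ : Cardinal.{u}) : Prop where
  bddAbove : ∀ s : Set K, #s < κ → BddAbove s
  mk_Iic_lt : ∀ v : K, #(Iic v) < κ
  le_mk : κ ≤ #K

theorem IsThin.of_bddAbove {A : Set K} (h : BddAbove A) : IsThin A :=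
  ⟨id, fun _ => h.mono fun _ hx => hx.1⟩

theorem IsThin.mono {A B : Set K} (hB : IsThin B) (h : A ⊆ B) : IsThin A := by
  obtain ⟨f, hf⟩ := hB
  exact ⟨f, fun v => (hf v).mono (by rintro δ ⟨h1, h2⟩; exact ⟨h h1, h2⟩)⟩

theorem exists_not_bddAbove_of_not_isThin {A : Set K} (hA : ¬ IsThin A) {f : K → K}
    (hf : ∀ δ ∈ A, f δ < δ) : ∃ v, ¬ BddAbove {δ ∈ A | f δ ≤ v} := by
  by_contra! H
  exact hA ⟨f, fun v => (H v).mono (by rintro δ ⟨h1, h2⟩; exact ⟨h1, h2 (hf δ h1)⟩)⟩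

namespace IsRegularOrder

variable {κ : Cardinal.{u}} (hK : IsRegularOrder K κ)
include hK

theorem mk_lt_of_bddAbove {s : Set K} (h : BddAbove s) : #s < κ := by
  obtain ⟨v, hv⟩ := h
  exact (mk_le_mk_of_subset fun x hx => hv hx).trans_lt (hK.mk_Iic_lt v)

theorem exists_gt (v : K) : ∃ w, v < w := by
  by_contra! H
  have : #(univ : Set K) < κ := hK.mk_lt_of_bddAbove ⟨v, fun w _ => H w⟩
  rw [mk_univ] at this
  exact this.not_ge hK.le_mk

theorem bddAbove_iUnion {ι : Type u} (hι : #ι < κ) {s : ι → Set K}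
    (hs : ∀ i, BddAbove (s i)) : BddAbove (⋃ i, s i) := by
  choose b hb using hs
  obtain ⟨B, hB⟩ := hK.bddAbove (range b) (mk_range_le.trans_lt hι)
  refine ⟨B, fun x hx => ?_⟩
  obtain ⟨i, hi⟩ := mem_iUnion.1 hx
  exact (hb i hi).trans (hB ⟨i, rfl⟩)

theorem bddAbove_iUnion_nat (hκ : ℵ₀ < κ) {s : ℕ → Set K}
    (hs : ∀ i, BddAbove (s i)) : BddAbove (⋃ i, s i) := by
  have := hK.bddAbove_iUnion (ι := ULift.{u} ℕ) (s := fun i => s i.down) (by simpa using hκ)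
    fun i => hs _
  exact this.mono fun x hx => by
    obtain ⟨i, hi⟩ := mem_iUnion.1 hx
    exact mem_iUnion.2 ⟨⟨i⟩, hi⟩

theorem isThin_iUnion_nat (hκ : ℵ₀ < κ) {A : ℕ → Set K} (hA : ∀ n, IsThin (A n)) :
    IsThin (⋃ n, A n) := by
  classical
  choose h hh using hA
  refine ⟨fun δ => if H : ∃ n, δ ∈ A n then h (Nat.find H) δ else δ, fun v => ?_⟩
  refine (hK.bddAbove_iUnion_nat hκ fun n => hh n v).mono ?_
  rintro δ ⟨hδ, hv⟩
  have H : ∃ n, δ ∈ A n := mem_iUnion.1 hδ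
  simp only [dif_pos H] at hv
  exact mem_iUnion.2 ⟨_, Nat.find_spec H, hv⟩

/-- The pressing down lemma. -/
theorem exists_not_isThin_fiber {A : Set K} (hA : ¬ IsThin A) {f : K → K}
    (hf : ∀ δ ∈ A, f δ < δ) : ∃ v, ¬ IsThin {δ ∈ A | f δ = v} := by
  classical
  by_contra! H
  choose h hh using H
  -- A diagonal union: a value at most `v` forces `f δ ≤ v`, so only the fewer than `κ` fibres over
  -- `Iic v` contribute.
  refine hA ⟨fun δ => if h (f δ) δ < δ then max (f δ) (h (f δ) δ) else f δ, fun v => ?_⟩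
  refine (hK.bddAbove_iUnion (hK.mk_Iic_lt v) fun w : Iic v => hh w v).mono ?_
  rintro δ ⟨hδ, hv⟩
  have hlt := hf δ hδ
  by_cases hc : h (f δ) δ < δ
  · simp only [if_pos hc] at hv
    have := hv (max_lt hlt hc)
    exact mem_iUnion.2 ⟨⟨f δ, (le_max_left _ _).trans this⟩, ⟨hδ, rfl⟩,
      fun _ => (le_max_right _ _).trans this⟩
  · simp only [if_neg hc] at hv
    exact mem_iUnion.2 ⟨⟨f δ, hv hlt⟩, ⟨hδ, rfl⟩, fun h => absurd h hc⟩

/-- Iterating past the bounds of the sublevel sets gives a sequence whose supremum `δ` is a closure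
point: `h δ` lies below some `x n`, so `δ` would be at most `b (x n) < x (n + 1)`. -/
theorem not_isThin_countablyApproachable [WellFoundedLT K] (hκ : ℵ₀ < κ) :
    ¬ IsThin (countablyApproachable K) := by
  rintro ⟨h, hh⟩
  choose b hb using hh
  choose s hs using hK.exists_gt
  have : Nonempty K := by
    rw [← mk_ne_zero_iff]
    exact (aleph0_pos.trans (hκ.trans_le hK.le_mk)).ne'
  let x : ℕ → K := fun n => Nat.rec (Classical.arbitrary K) (fun _ y => s (max y (b y))) n
  have hx : ∀ n, max (x n) (b (x n)) < x (n + 1) := fun n => hs _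
  obtain ⟨B, hB⟩ := hK.bddAbove_iUnion_nat hκ fun n => (bddAbove_singleton (a := x n))
  obtain ⟨δ, hδ, hmin⟩ := (wellFounded_lt (α := K)).has_min (upperBounds (range x))
    ⟨B, by rintro _ ⟨n, rfl⟩; exact hB (mem_iUnion.2 ⟨n, rfl⟩)⟩
  have hlt : ∀ n, x n < δ := fun n =>
    ((le_max_left _ _).trans_lt (hx n)).trans_le (hδ ⟨n + 1, rfl⟩)
  have hcof : ∀ y < δ, ∃ n, y < x n := by
    intro y hy
    by_contra! H
    exact hmin y (by rintro _ ⟨n, rfl⟩; exact H n) hy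
  have hmem : δ ∈ countablyApproachable K :=
    ⟨x, hlt, fun y hy => (hcof y hy).imp fun _ => le_of_lt⟩
  have key : ∃ n, δ ≤ b (x n) := by
    by_cases hc : h δ < δ
    · obtain ⟨n, hn⟩ := hcof _ hc
      exact ⟨n, hb _ ⟨hmem, fun _ => hn.le⟩⟩
    · exact ⟨0, hb _ ⟨hmem, fun h => absurd h hc⟩⟩
  obtain ⟨n, hn⟩ := key
  exact (hn.trans_lt ((le_max_right _ _).trans_lt (hx n))).not_ge (hδ ⟨n + 1, rfl⟩)

/-- The countably approachable points contain `κ` many disjoint sets that are not thin. -/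
theorem exists_disjoint_not_isThin [WellFoundedLT K] (hκ : ℵ₀ < κ) {ι : Type u} (hι : #ι ≤ κ) :
    ∃ A : ι → Set K, Pairwise (Function.onFun Disjoint A) ∧
      (∀ i, A i ⊆ countablyApproachable K) ∧ ∀ i, ¬ IsThin (A i) := by
  classical
  set S := countablyApproachable K with hS
  have hSthin := hK.not_isThin_countablyApproachable hκ
  choose! c hc hcof using fun (δ : K) (hδ : δ ∈ S) => hδ
  -- Some coordinate `n` of the cofinal sequences is stationarily often above every `η`. Pressing
  -- down on it then gives non-thin fibres over unboundedly many values, hence over `κ` many.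
  have key : ∃ n, ∀ η, ¬ IsThin {δ ∈ S | η ≤ c δ n} := by
    by_contra! H
    choose η hη using H
    obtain ⟨B, hB⟩ := hK.bddAbove_iUnion_nat hκ fun n => (bddAbove_singleton (a := η n))
    have hB' : ∀ n, η n ≤ B := fun n => hB (mem_iUnion.2 ⟨n, rfl⟩)
    refine hSthin ((hK.isThin_iUnion_nat hκ
      (A := fun n => {δ ∈ S | η n ≤ c δ n} ∪ Iic B) fun n => ?_).mono fun δ hδ => ?_)
    · obtain ⟨f, hf⟩ := hη n
      refine ⟨f, fun v => ((hf v).union (bddAbove_Iic (a := B))).mono ?_⟩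
      rintro δ ⟨h1 | h1, h2⟩
      · exact Or.inl ⟨h1, h2⟩
      · exact Or.inr h1
    · rcases le_or_gt δ B with h | h
      · exact mem_iUnion.2 ⟨0, Or.inr h⟩
      · obtain ⟨n, hn⟩ := hcof δ hδ B h
        exact mem_iUnion.2 ⟨n, Or.inl ⟨hδ, (hB' n).trans hn⟩⟩
  obtain ⟨n, hn⟩ := key
  let V : Set K := {v | ¬ IsThin {δ ∈ S | c δ n = v}}
  have hV : κ ≤ #V := by
    by_contra! H
    obtain ⟨B, hB⟩ := hK.bddAbove V H
    obtain ⟨η, hη⟩ := hK.exists_gt B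
    obtain ⟨v, hv⟩ := hK.exists_not_isThin_fiber (hn η) (f := fun δ => c δ n)
      fun δ hδ => hc δ hδ.1 n
    have hvV : v ∈ V := fun h => hv (h.mono fun δ hδ => ⟨hδ.1.1, hδ.2⟩)
    have : Nonempty K := ⟨v⟩
    refine hv ((IsThin.of_bddAbove bddAbove_empty).mono ?_)
    rintro δ ⟨⟨_, h1⟩, h2⟩
    exact absurd (hη.trans_le (h1.trans h2.le)) (hB hvV).not_gt
  obtain ⟨e⟩ := (Cardinal.le_def _ _).1 (hι.trans hV)
  refine ⟨fun i => {δ ∈ S | c δ n = e i}, ?_, fun i δ hδ => hδ.1, fun i => (e i).2⟩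
  intro i j hij
  refine Set.disjoint_left.2 ?_
  rintro δ ⟨_, h1⟩ ⟨_, h2⟩
  exact hij (e.injective (Subtype.ext (h1.symm.trans h2)))

end IsRegularOrder

theorem isRegularOrder_toType {κ : Cardinal.{u}} (hκ : κ.IsRegular) :
    IsRegularOrder κ.ord.ToType κ where
  bddAbove s hs := by
    by_contra H
    rw [not_bddAbove_iff] at H
    have hs' : IsCofinal s := fun x => by
      obtain ⟨y, hy, hxy⟩ := H x
      exact ⟨y, hy, hxy.le⟩
    have := Order.cof_le hs'
    rw [Ordinal.cof_toType, hκ.cof_ord] at this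
    exact this.not_gt hs
  mk_Iic_lt v := by
    rw [← Iio_union_right]
    refine (mk_union_le _ _).trans_lt (add_lt_of_lt hκ.aleph0_le ?_ ?_)
    · simpa using mk_Iio_lt v (by simp)
    · rw [mk_singleton]
      exact one_lt_aleph0.trans_le hκ.aleph0_le
  le_mk := by simp

end Thin

/-! ### Initial parts of a left-separating order. -/

section LowerBound

variable {K : Type u} [LinearOrder K] {κ : Cardinal.{u}}

/-- An ordinal of cofinality `κ` is a limit along an order whose bounded sets are small. -/
theorem IsRegularOrder.exists_tendsto_of_cof_eq (hK : IsRegularOrder K κ) (hκ : ℵ₀ ≤ κ)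
    {i : Ordinal.{u}} (hi : i.cof = κ) :
    ∃ g : K → Ordinal.{u}, (∀ δ, g δ < i) ∧ ∀ j < i, ∃ ρ, ∀ δ, ρ ≤ δ → j < g δ := by
  have hlim : Order.IsSuccLimit i := by
    rw [← Ordinal.one_lt_cof_iff, hi]
    exact one_lt_aleph0.trans_le hκ
  obtain ⟨s, hs, hsc⟩ := Order.exists_cof_eq i.ToType
  rw [Ordinal.cof_toType, hi] at hsc
  obtain ⟨e⟩ := (Cardinal.le_def _ _).1 (hsc.le.trans hK.le_mk)
  let val : i.ToType → Ordinal.{u} := fun x => (Ordinal.ToType.mk.symm x).1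
  have hval : ∀ x, val x < i := fun x => (Ordinal.ToType.mk.symm x).2
  -- The supremum runs over fewer than `κ = i.cof` elements of a cofinal set, so it stays below `i`.
  refine ⟨fun δ => ⨆ x : {x : s // e x ≤ δ}, val x.1.1, fun δ => ?_, fun j hj => ?_⟩
  · refine Ordinal.iSup_lt_of_lt_cof ?_ fun x => hval _
    rw [hi]
    refine lt_of_le_of_lt ?_ (hK.mk_Iic_lt δ)
    exact mk_le_of_injective (f := fun x : {x : s // e x ≤ δ} => (⟨e x.1, x.2⟩ : Iic δ))
      fun x y hxy => Subtype.ext (e.injective (congrArg Subtype.val hxy))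
  · have hj' : j + 1 < i := hlim.add_one_lt hj
    obtain ⟨x, hx, hjx⟩ := hs (Ordinal.ToType.mk ⟨j + 1, hj'⟩)
    have hjx' : j + 1 ≤ val x := by
      have := Ordinal.ToType.mk.symm.monotone hjx
      rw [OrderIso.symm_apply_apply] at this
      exact this
    refine ⟨e ⟨x, hx⟩, fun δ hδ => (Order.lt_add_one_iff.2 le_rfl).trans_le (hjx'.trans ?_)⟩
    exact Ordinal.le_iSup (fun x : {x : s // e x ≤ δ} => val x.1.1) ⟨⟨x, hx⟩, hδ⟩

variable {Y : Set K} {L pos : K → Ordinal.{u}}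

/-- Suppose that every point of `Y` precedes, in the ordering given by `pos`, all points of higher
level just below it. Then boundedness of initial parts passes from a set that is not thin to sets
of higher levels. -/
theorem bddAbove_of_forall_lt_bddAbove
    (hpos : ∀ y ∈ Y, ∃ γ < y, ∀ z ∈ Y, γ < z → z < y → L y < L z → pos y < pos z)
    {A B : Set K} (hAY : A ⊆ Y) (hBY : B ⊆ Y) (hA : ¬ IsThin A)
    (hAB : ∃ ρ, ∀ ε ∈ B, ρ < ε → ∀ δ ∈ A, L δ < L ε) {ξ : Ordinal.{u}}
    (h : ∀ ξ' < ξ, BddAbove {δ ∈ A | pos δ < ξ'}) : BddAbove {δ ∈ B | pos δ < ξ} := by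
  by_contra H
  rw [not_bddAbove_iff] at H
  choose! γ hγ hγ' using hpos
  obtain ⟨ρ, hρ⟩ := hAB
  -- Any `ε ∈ B` above `ρ` and `v` comes after every `δ > ε` in `A` with `γ δ ≤ v`.
  obtain ⟨v, hv⟩ := exists_not_bddAbove_of_not_isThin hA fun δ hδ => hγ δ (hAY hδ)
  obtain ⟨ε, ⟨hεB, hεξ⟩, hε⟩ := H (max ρ v)
  refine hv (((h _ hεξ).union (bddAbove_Iic (a := ε))).mono ?_)
  rintro δ ⟨hδ, hδv⟩
  rcases le_or_gt δ ε with hle | hlt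
  · exact Or.inr hle
  · exact Or.inl ⟨hδ, hγ' δ (hAY hδ) ε (hBY hεB) (hδv.trans_lt ((le_max_right _ _).trans_lt hε))
      hlt (hρ ε hεB ((le_max_left _ _).trans_lt hε) δ hδ)⟩

/-- By injectivity, fewer than `κ` points have positions in `[ξ, ξ + β)`. -/
theorem IsRegularOrder.bddAbove_add (hK : IsRegularOrder K κ) {B : Set K}
    (hinj : InjOn pos B) {ξ β : Ordinal.{u}} (hβ : β < κ.ord)
    (h : BddAbove {δ ∈ B | pos δ < ξ}) : BddAbove {δ ∈ B | pos δ < ξ + β} := by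
  have h2 : BddAbove {δ ∈ B | ξ ≤ pos δ ∧ pos δ < ξ + β} := by
    refine hK.bddAbove _ ?_
    have hmap : ∀ δ : {δ ∈ B | ξ ≤ pos δ ∧ pos δ < ξ + β}, pos δ.1 - ξ < β := fun δ => by
      have h1 := δ.2.2.2
      rw [← Ordinal.add_sub_cancel_of_le δ.2.2.1] at h1
      exact lt_of_add_lt_add_left h1
    have : #{δ ∈ B | ξ ≤ pos δ ∧ pos δ < ξ + β} ≤ #β.ToType := by
      refine mk_le_of_injective (f := fun δ => Ordinal.ToType.mk ⟨pos δ.1 - ξ, hmap δ⟩) ?_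
      intro x y hxy
      have hxy' : pos x.1 - ξ = pos y.1 - ξ :=
        congrArg Subtype.val (Ordinal.ToType.mk.injective hxy)
      refine Subtype.ext (hinj x.2.1 y.2.1 ?_)
      rw [← Ordinal.add_sub_cancel_of_le x.2.2.1, hxy', Ordinal.add_sub_cancel_of_le y.2.2.1]
    rw [mk_toType] at this
    exact this.trans_lt (lt_ord.1 hβ)
  refine (h.union h2).mono ?_
  rintro δ ⟨h1, h3⟩
  rcases lt_or_ge (pos δ) ξ with h4 | h4
  · exact Or.inl ⟨h1, h4⟩
  · exact Or.inr ⟨h1, h4, h3⟩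

/-- If `B i` consists of points of level `i`, and below every level of cofinality `κ` there is a
set `B' i` that is not thin and has levels converging to `i`, then the part of `B i` that comes
before the position `κ * i + β` is bounded. -/
theorem IsRegularOrder.bddAbove_mul_add (hK : IsRegularOrder K κ) (hκ : κ.IsRegular)
    {α : Ordinal.{u}} (hα : α < (Order.succ κ).ord)
    (hpos : ∀ y ∈ Y, ∃ γ < y, ∀ z ∈ Y, γ < z → z < y → L y < L z → pos y < pos z)
    (hinj : InjOn pos Y) {B B' : Ordinal.{u} → Set K}
    (hB : ∀ i < α, B i ⊆ Y ∧ ¬ IsThin (B i) ∧ ∀ δ ∈ B i, L δ = i)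
    (hB' : ∀ i < α, i.cof = κ → B' i ⊆ Y ∧ ¬ IsThin (B' i) ∧ (∀ δ ∈ B' i, L δ < i) ∧
      ∀ j < i, ∃ ρ, ∀ δ ∈ B' i, ρ ≤ δ → j < L δ)
    (i : Ordinal.{u}) (hi : i < α) :
    ∀ β < κ.ord, BddAbove {δ ∈ B i | pos δ < κ.ord * i + β} := by
  induction i using WellFoundedLT.induction with
  | ind i IH =>
  intro β hβ
  obtain ⟨hBY, hBthin, hBL⟩ := hB i hi
  refine hK.bddAbove_add (hinj.mono hBY) hβ ?_
  have prev : ∀ j < i, ∀ ξ' < κ.ord * (j + 1), BddAbove {δ ∈ B j | pos δ < ξ'} := by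
    intro j hj ξ' hξ'
    rw [mul_add_one, Ordinal.lt_add_iff (ord_pos.2 hκ.pos).ne'] at hξ'
    obtain ⟨r, hr, hξ'⟩ := hξ'
    exact (IH j hj (hj.trans hi) r hr).mono
      (by rintro δ ⟨h1, h2⟩; exact ⟨h1, h2.trans_le hξ'⟩)
  have step : ∀ j < i, BddAbove {δ ∈ B i | pos δ < κ.ord * (j + 1)} := by
    intro j hj
    obtain ⟨hjY, hjthin, hjL⟩ := hB j (hj.trans hi)
    obtain ⟨ρ⟩ : Nonempty K := by
      rw [← mk_ne_zero_iff]
      exact (hκ.pos.trans_le hK.le_mk).ne'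
    refine bddAbove_of_forall_lt_bddAbove hpos hjY hBY hjthin ⟨ρ, fun ε hε _ δ hδ => ?_⟩
      (prev j hj)
    rwa [hjL δ hδ, hBL ε hε]
  rcases Ordinal.zero_or_succ_or_isSuccLimit i with rfl | ⟨j, rfl⟩ | hlim
  · refine hK.bddAbove _ ?_
    simp [hκ.pos]
  · exact step j (Order.lt_succ j)
  · have hcofle : i.cof ≤ κ := by
      refine (Ordinal.cof_le_card i).trans (Order.lt_succ_iff.1 (lt_ord.1 (hi.trans hα)))
    rcases hcofle.lt_or_eq with hlt | heq
    · obtain ⟨s, hs, hsc⟩ := Order.exists_cof_eq i.ToType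
      rw [Ordinal.cof_toType] at hsc
      refine (hK.bddAbove_iUnion (hsc.trans_lt hlt) fun x : s =>
        step (Ordinal.ToType.mk.symm x.1).1 (Ordinal.ToType.mk.symm x.1).2).mono ?_
      rintro δ ⟨hδ, hδi⟩
      obtain ⟨j, hj, hδj⟩ := (Ordinal.lt_mul_iff_of_isSuccLimit hlim).1 hδi
      obtain ⟨x, hx, hjx⟩ := hs (Ordinal.ToType.mk ⟨j, hj⟩)
      have hjx' : j ≤ (Ordinal.ToType.mk.symm x).1 := by
        have := Ordinal.ToType.mk.symm.monotone hjx
        rw [OrderIso.symm_apply_apply] at this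
        exact this
      refine mem_iUnion.2 ⟨⟨x, hx⟩, hδ, hδj.trans_le ?_⟩
      gcongr
      exact hjx'.trans (Order.lt_add_one_iff.2 le_rfl).le
    -- A union of `κ` many bounded sets may be unbounded. So boundedness passes from each `B j` to
    -- `B' i`, whose levels eventually exceed `j`, and from `B' i` to `B i`.
    · obtain ⟨hCY, hCthin, hCL, hCj⟩ := hB' i hi heq
      obtain ⟨ρ⟩ : Nonempty K := by
        rw [← mk_ne_zero_iff]
        exact (hκ.pos.trans_le hK.le_mk).ne'
      refine bddAbove_of_forall_lt_bddAbove hpos hCY hBY hCthin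
        ⟨ρ, fun ε hε _ δ hδ => by rw [hBL ε hε]; exact hCL δ hδ⟩ fun ξ' hξ' => ?_
      obtain ⟨j, hj, hξj⟩ := (Ordinal.lt_mul_iff_of_isSuccLimit hlim).1 hξ'
      obtain ⟨hjY, hjthin, hjL⟩ := hB j (hj.trans hi)
      have hle : ξ' ≤ κ.ord * (j + 1) :=
        hξj.le.trans (by gcongr; exact (Order.lt_add_one_iff.2 le_rfl).le)
      refine bddAbove_of_forall_lt_bddAbove hpos hjY hCY hjthin ?_
        fun ξ'' h'' => prev j hj ξ'' (h''.trans_le hle)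
      obtain ⟨ρ, hρ⟩ := hCj j hj
      exact ⟨ρ, fun ε hε hρε δ hδ => by rw [hjL δ hδ]; exact hρ ε hε hρε.le⟩

end LowerBound

/-! ### The topology given by levels. -/

section LevelSpace

variable {K : Type u} [LinearOrder K]

/-- The countably approachable points of `Y`. They carry the topology in which the basic
neighbourhoods of `δ` consist of `δ` and of the points of higher level in an interval below `δ`. -/
@[ext]
structure LevelSpace (Y : Set K) (L : K → Ordinal.{u}) : Type u where
  /-- The underlying point. -/
  val : K
  property : val ∈ Y ∧ val ∈ countablyApproachable K

namespace LevelSpace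

variable {Y : Set K} {L : K → Ordinal.{u}}

/-- The basic neighbourhood of a point determined by a lower end point. -/
def basicNhd (γ : K) (δ : LevelSpace Y L) : Set (LevelSpace Y L) :=
  {ε | ε = δ ∨ γ < ε.1 ∧ ε.1 < δ.1 ∧ L δ.1 < L ε.1}

theorem exists_lt (δ : LevelSpace Y L) : ∃ γ, γ < δ.1 := by
  obtain ⟨c, hc, -⟩ := δ.2.2
  exact ⟨c 0, hc 0⟩

theorem mem_basicNhd_self (γ : K) (δ : LevelSpace Y L) : δ ∈ basicNhd γ δ := Or.inl rfl

theorem basicNhd_subset {γ γ' : K} (h : γ ≤ γ') (δ : LevelSpace Y L) :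
    basicNhd γ' δ ⊆ basicNhd γ δ := by
  rintro ε (rfl | ⟨h1, h2⟩)
  · exact Or.inl rfl
  · exact Or.inr ⟨h.trans_lt h1, h2⟩

theorem basicNhd_trans {γ : K} {δ ε : LevelSpace Y L} (h : ε ∈ basicNhd γ δ) :
    basicNhd γ ε ⊆ basicNhd γ δ := by
  rcases h with rfl | ⟨_, h2, h3⟩
  · exact subset_rfl
  · rintro ζ (rfl | ⟨h4, h5, h6⟩)
    · exact Or.inr ⟨‹_›, h2, h3⟩
    · exact Or.inr ⟨h4, h5.trans h2, h3.trans h6⟩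

instance : TopologicalSpace (LevelSpace Y L) where
  IsOpen U := ∀ δ ∈ U, ∃ γ < δ.1, basicNhd γ δ ⊆ U
  isOpen_univ δ _ := by
    obtain ⟨γ, hγ⟩ := exists_lt δ
    exact ⟨γ, hγ, subset_univ _⟩
  isOpen_inter U V hU hV δ hδ := by
    obtain ⟨γ, hγ, h⟩ := hU δ hδ.1
    obtain ⟨γ', hγ', h'⟩ := hV δ hδ.2
    exact ⟨max γ γ', max_lt hγ hγ', subset_inter
      ((basicNhd_subset (le_max_left _ _) δ).trans h)
      ((basicNhd_subset (le_max_right _ _) δ).trans h')⟩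
  isOpen_sUnion S hS δ := by
    rintro ⟨U, hU, hδ⟩
    obtain ⟨γ, hγ, h⟩ := hS U hU δ hδ
    exact ⟨γ, hγ, h.trans (subset_sUnion_of_mem hU)⟩

theorem isOpen_iff {U : Set (LevelSpace Y L)} :
    IsOpen U ↔ ∀ δ ∈ U, ∃ γ < δ.1, basicNhd γ δ ⊆ U := Iff.rfl

theorem isOpen_basicNhd {γ : K} {δ : LevelSpace Y L} (h : γ < δ.1) : IsOpen (basicNhd γ δ) := by
  intro ε hε
  refine ⟨γ, ?_, basicNhd_trans hε⟩
  rcases hε with rfl | ⟨h1, -⟩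
  · exact h
  · exact h1

theorem mem_nhds_iff {δ : LevelSpace Y L} {s : Set (LevelSpace Y L)} :
    s ∈ nhds δ ↔ ∃ γ < δ.1, basicNhd γ δ ⊆ s := by
  rw [_root_.mem_nhds_iff]
  constructor
  · rintro ⟨t, hts, ht, hδ⟩
    obtain ⟨γ, hγ, h⟩ := ht δ hδ
    exact ⟨γ, hγ, h.trans hts⟩
  · rintro ⟨γ, hγ, h⟩
    exact ⟨_, h, isOpen_basicNhd hγ, mem_basicNhd_self γ δ⟩

instance : FirstCountableTopology (LevelSpace Y L) where
  nhds_generated_countable δ := by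
    obtain ⟨c, hc, hcof⟩ := δ.2.2
    refine Filter.HasBasis.isCountablyGenerated (ι := ℕ) (p := fun _ => True)
      (s := fun n => basicNhd (c n) δ) ⟨fun s => ?_⟩
    rw [mem_nhds_iff]
    constructor
    · rintro ⟨γ, hγ, h⟩
      obtain ⟨n, hn⟩ := hcof γ hγ
      exact ⟨n, trivial, (basicNhd_subset hn δ).trans h⟩
    · rintro ⟨n, -, h⟩
      exact ⟨c n, hc n, h⟩

instance : T2Space (LevelSpace Y L) where
  t2 := by
    have key : ∀ δ ε : LevelSpace Y L, δ.1 < ε.1 → ∃ u v : Set (LevelSpace Y L),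
        IsOpen u ∧ IsOpen v ∧ δ ∈ u ∧ ε ∈ v ∧ Disjoint u v := by
      intro δ ε h
      obtain ⟨γ, hγ⟩ := exists_lt δ
      -- The smaller point `δ` serves as the lower end for `ε`, since neighbourhoods of `δ` lie in
      -- `Iic δ`.
      refine ⟨_, _, isOpen_basicNhd hγ, isOpen_basicNhd h, mem_basicNhd_self _ _,
        mem_basicNhd_self _ _, Set.disjoint_left.2 fun ζ h1 h2 => ?_⟩
      have h3 : ζ.1 ≤ δ.1 := by
        rcases h1 with rfl | ⟨-, h1, -⟩
        exacts [le_rfl, h1.le]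
      rcases h2 with rfl | ⟨h2, -⟩
      · exact h3.not_gt h
      · exact h3.not_gt h2
    intro δ ε hne
    rcases lt_or_gt_of_ne (fun h => hne (LevelSpace.ext h) : δ.1 ≠ ε.1) with h | h
    · exact key δ ε h
    · obtain ⟨u, v, hu, hv, h1, h2, h3⟩ := key ε δ h
      exact ⟨v, u, hv, hu, h2, h1, h3.symm⟩

theorem isScattered [WellFoundedLT K] : IsScattered (LevelSpace Y L) := by
  intro S hS
  obtain ⟨δ, hδ, hmin⟩ := (InvImage.wf (fun δ : LevelSpace Y L => δ.1)
    (wellFounded_lt (α := K))).has_min S hS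
  obtain ⟨γ, hγ⟩ := exists_lt δ
  refine ⟨⟨δ, hδ⟩, isOpen_induced_iff.2 ⟨_, isOpen_basicNhd hγ, ?_⟩⟩
  ext ε
  constructor
  · rintro (h | ⟨-, h, -⟩)
    · exact Subtype.ext h
    · exact absurd h (hmin _ ε.2)
  · rintro rfl
    exact mem_basicNhd_self _ _

/-- A left-separating ordering puts each point before the points of higher level just below it. -/
theorem exists_lt_forall_of_isLeftSeparating {r : LevelSpace Y L → LevelSpace Y L → Prop}
    (hr : IsLeftSeparating r) (δ : LevelSpace Y L) :
    ∃ γ < δ.1, ∀ ε : LevelSpace Y L, γ < ε.1 → ε.1 < δ.1 → L δ.1 < L ε.1 → r δ ε := by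
  have := hr.isWellOrder
  obtain ⟨γ, hγ, h⟩ := isOpen_iff.1 (hr.isClosed_initial δ).isOpen_compl δ (irrefl_of r δ)
  refine ⟨γ, hγ, fun ε h1 h2 h3 => ?_⟩
  have h4 : ¬ r ε δ := h (Or.inr ⟨h1, h2, h3⟩)
  rcases trichotomous_of r δ ε with h5 | rfl | h5
  · exact h5
  · exact absurd h2 (lt_irrefl _)
  · exact absurd h5 h4

/-- An ordering which refines the ordering by levels is left-separating. -/
theorem isLeftSeparating_of_level {f : LevelSpace Y L → Ordinal.{u}} (hf : Function.Injective f)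
    (hL : ∀ δ ε : LevelSpace Y L, L δ.1 < L ε.1 → f δ < f ε) :
    IsLeftSeparating fun δ ε : LevelSpace Y L => f δ < f ε where
  isWellOrder := (RelEmbedding.preimage ⟨f, hf⟩ (· < ·)).isWellOrder
  isClosed_initial δ := by
    rw [← isOpen_compl_iff, isOpen_iff]
    intro ε hε
    obtain ⟨γ, hγ⟩ := exists_lt ε
    refine ⟨γ, hγ, ?_⟩
    rintro ζ (rfl | ⟨-, -, h⟩)
    · exact hε
    · exact fun h' => hε ((hL _ _ h).trans h')

end LevelSpace

end LevelSpace

/-! ### Choice of levels and computation of the type. -/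

theorem theorem1p1 (κ : Cardinal.{u}) (hreg : κ.IsRegular) (hunc : Cardinal.aleph0 < κ)
    (α : Ordinal.{u}) (hα : α < (Order.succ κ).ord) :
    ∃ (Y : Type u) (_ : TopologicalSpace Y),
      FirstCountableTopology Y ∧ IsScattered Y ∧ T2Space Y ∧
      IsLeftSeparated Y ∧ leftSeparatingType Y = κ.ord * α := by
  classical
  have hK := isRegularOrder_toType hreg
  have hK0 : κ.ord ≠ 0 := (ord_pos.2 hreg.pos).ne'
  have hg : ∀ i : Ordinal.{u}, ∃ g : κ.ord.ToType → Ordinal.{u}, (∀ δ, g δ ≤ i) ∧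
      (i.cof = κ → (∀ δ, g δ < i) ∧ ∀ j < i, ∃ ρ, ∀ δ, ρ ≤ δ → j < g δ) := by
    intro i
    by_cases hi : i.cof = κ
    · obtain ⟨g, hg, hg'⟩ := hK.exists_tendsto_of_cof_eq hunc.le hi
      exact ⟨g, fun δ => (hg δ).le, fun _ => ⟨hg, hg'⟩⟩
    · exact ⟨fun _ => i, fun _ => le_rfl, fun h => absurd h hi⟩
  choose g hgle hgcof using hg
  have hcard : #(α.ToType × Bool) ≤ κ := by
    have h1 : α.card ≤ κ := Order.lt_succ_iff.1 (lt_ord.1 hα)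
    simp only [mk_prod, mk_toType, mk_bool, lift_uzero, lift_ofNat]
    exact mul_le_of_le hreg.aleph0_le h1 ((natCast_lt_aleph0 (n := 2)).le.trans hunc.le)
  -- Two sets for each `i < α`: `false` has constant level `i`, `true` has level `g i`, converging
  -- to `i` from below when `i.cof = κ`.
  obtain ⟨A, hdisj, hAS, hA⟩ := hK.exists_disjoint_not_isThin hunc hcard
  let lev : α.ToType × Bool → κ.ord.ToType → Ordinal.{u} := fun p δ =>
    if p.2 then g (Ordinal.ToType.mk.symm p.1).1 δ else (Ordinal.ToType.mk.symm p.1).1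
  have hlev : ∀ p δ, lev p δ < α := by
    intro p δ
    have := (Ordinal.ToType.mk.symm p.1).2
    by_cases hp : p.2
    · simp only [lev, if_pos hp]
      exact (hgle _ δ).trans_lt this
    · simp only [lev, if_neg hp]
      exact this
  let Y : Set κ.ord.ToType := ⋃ p, A p
  let L : κ.ord.ToType → Ordinal.{u} := fun δ =>
    if h : ∃ p, δ ∈ A p then lev h.choose δ else 0
  have hL : ∀ p, ∀ δ ∈ A p, L δ = lev p δ := by
    intro p δ hδ
    have h : ∃ p, δ ∈ A p := ⟨p, hδ⟩
    have hp : h.choose = p := by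
      by_contra hne
      exact Set.disjoint_left.1 (hdisj hne) h.choose_spec hδ
    simp only [L, dif_pos h, hp]
  have hYS : ∀ δ ∈ Y, δ ∈ countablyApproachable κ.ord.ToType := fun δ hδ => by
    obtain ⟨p, hp⟩ := mem_iUnion.1 hδ
    exact hAS p hp
  have hLα : ∀ δ ∈ Y, L δ < α := fun δ hδ => by
    obtain ⟨p, hp⟩ := mem_iUnion.1 hδ
    rw [hL p δ hp]
    exact hlev p δ
  let f : LevelSpace Y L → Ordinal.{u} := fun δ =>
    κ.ord * L δ.1 + (Ordinal.ToType.mk.symm δ.1).1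
  have hfdiv : ∀ δ, f δ / κ.ord = L δ.1 := fun δ => by
    simp only [f]
    rw [Ordinal.mul_add_div _ hK0,
      Ordinal.div_eq_zero_of_lt (Ordinal.ToType.mk.symm δ.1).2, add_zero]
  have hfinj : Function.Injective f := by
    intro δ ε h
    have h1 : L δ.1 = L ε.1 := by rw [← hfdiv, h, hfdiv]
    simp only [f, h1] at h
    exact LevelSpace.ext (Ordinal.ToType.mk.symm.injective (Subtype.ext (add_left_cancel h)))
  have hfL : ∀ δ ε : LevelSpace Y L, L δ.1 < L ε.1 → f δ < f ε := by
    intro δ ε h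
    by_contra! H
    have := Ordinal.div_le_left H κ.ord
    rw [hfdiv, hfdiv] at this
    exact this.not_gt h
  have hfα : ∀ δ, f δ < κ.ord * α := fun δ =>
    Ordinal.lt_mul_iff.2 ⟨_, hLα _ δ.2.1, _, (Ordinal.ToType.mk.symm δ.1).2, rfl⟩
  have hsep := LevelSpace.isLeftSeparating_of_level hfinj hfL
  refine ⟨LevelSpace Y L, inferInstance, inferInstance, LevelSpace.isScattered, inferInstance,
    ⟨_, hsep⟩, le_antisymm ?_ ?_⟩
  · have := hsep.isWellOrder
    have hmem : Ordinal.type _ ∈ leftSeparatingOrderTypes (LevelSpace Y L) := ⟨_, hsep, rfl⟩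
    refine (csInf_le' hmem).trans ?_
    rw [← Ordinal.type_toType (κ.ord * α)]
    refine RelEmbedding.ordinal_type_le
      ⟨⟨fun δ => Ordinal.ToType.mk ⟨f δ, hfα δ⟩, fun δ ε h => ?_⟩, fun {δ ε} => ?_⟩
    · exact hfinj (congrArg Subtype.val (Ordinal.ToType.mk.injective h))
    · exact Ordinal.ToType.mk.lt_iff_lt
  · refine le_csInf ⟨_, _, hsep, rfl⟩ ?_
    rintro o ⟨r, hr, rfl⟩
    have := hr.isWellOrder
    by_contra! hlt
    -- A type below `κ * α` is `κ * i + β`, so all of `B false i` lies before that position.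
    obtain ⟨i, hi, β, hβ, htype⟩ := Ordinal.lt_mul_iff.1 hlt
    let pos : κ.ord.ToType → Ordinal.{u} := fun δ =>
      if h : δ ∈ Y then Ordinal.typein r (⟨δ, h, hYS δ h⟩ : LevelSpace Y L) else 0
    have hpos : ∀ δ (h : δ ∈ Y),
        pos δ = Ordinal.typein r (⟨δ, h, hYS δ h⟩ : LevelSpace Y L) := fun δ h => dif_pos h
    let B : Bool → Ordinal.{u} → Set κ.ord.ToType := fun b i =>
      if h : i < α then A (Ordinal.ToType.mk ⟨i, h⟩, b) else ∅
    have hBA : ∀ b i (h : i < α), B b i = A (Ordinal.ToType.mk ⟨i, h⟩, b) :=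
      fun b i h => dif_pos h
    have hBY : ∀ b, ∀ i < α, B b i ⊆ Y := fun b i h => by
      rw [hBA b i h]
      exact subset_iUnion A _
    have hBthin : ∀ b, ∀ i < α, ¬ IsThin (B b i) := fun b i h => by
      rw [hBA b i h]
      exact hA _
    have hBfalse : ∀ i < α, ∀ δ ∈ B false i, L δ = i := fun i h δ hδ => by
      rw [hBA _ i h] at hδ
      simp [hL _ δ hδ, lev]
    have hBtrue : ∀ i < α, ∀ δ ∈ B true i, L δ = g i δ := fun i h δ hδ => by
      rw [hBA _ i h] at hδ
      simp [hL _ δ hδ, lev]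
    have hbdd := hK.bddAbove_mul_add hreg hα (Y := Y) (L := L) (pos := pos)
      (B := B false) (B' := B true) ?_ ?_
      (fun i h => ⟨hBY _ i h, hBthin _ i h, hBfalse i h⟩)
      (fun i h hcof => ⟨hBY _ i h, hBthin _ i h,
        fun δ hδ => by rw [hBtrue i h δ hδ]; exact (hgcof i hcof).1 δ,
        fun j hj => ((hgcof i hcof).2 j hj).imp fun ρ hρ δ hδ hle => by
          rw [hBtrue i h δ hδ]; exact hρ δ hle⟩) i hi β hβ
    · refine hBthin false i hi ((IsThin.of_bddAbove hbdd).mono ?_)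
      intro δ hδ
      refine ⟨hδ, ?_⟩
      rw [hpos δ (hBY _ i hi hδ), ← htype]
      exact Ordinal.typein_lt_type r _
    · intro y hy
      obtain ⟨γ, hγ, h⟩ := LevelSpace.exists_lt_forall_of_isLeftSeparating hr
        (⟨y, hy, hYS y hy⟩ : LevelSpace Y L)
      refine ⟨γ, hγ, fun z hz h1 h2 h3 => ?_⟩
      rw [hpos y hy, hpos z hz, Ordinal.typein_lt_typein]
      exact h ⟨z, hz, hYS z hz⟩ h1 h2 h3
    · intro y hy z hz h
      rw [hpos y hy, hpos z hz, Ordinal.typein_inj] at h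
      exact congrArg LevelSpace.val h
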